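/- Let $E=\{a,b,c,d,e,f,g,h\}$ be a set of eight elements and let $\mathcal L$ be the family of the eight three-element sets $$\{a,f,d\},\{e,b,h\},\{a,b,g\},\{e,f,c\},\{e,g,d\},\{a,c,h\},\{b,c,d\},\{f,g,h\}.$$ Then the family $$\mathcal B=\{B\subseteq E : |B|=3,\ |B\cap L|\le 2 \text{ for all } L\in\mathcal L\}$$ is the family of bases of a matroid $M$ on $E$ of rank $3$, and the flats of rank $2$ of $M$ with at least three elements are exactly the members of $\mathcal L$. The matroid $M$ is simple (it has no loops and no parallel elements), connected (it is not a direct sum of two matroids with non-empty ground sets) and not binary (not representable over the field $\mathbb F_2$). Moreover, $M$ is minimal in the weak-map order among the connected matroids on $E$: if $N$ is a connected matroid on $E$ and every base of $N$ is a base of $M$, then $N=M$. Thus $M$ is a rank-$3$ example of a matroid of type (b), that is, a non-binary connected matroid which is minimal, with respect to inclusion of base systems, among the connected matroids on its ground set. -/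

import Mathlib

open Set

universe u

/-- A matroid is connected if it is not the direct sum of two matroids whose (disjoint) ground
sets are both non-empty. -/
def Matroid.IsConnectedMatroid {α : Type u} (M : Matroid α) : Prop :=
  ¬ ∃ (M₁ M₂ : Matroid α) (h : Disjoint M₁.E M₂.E),
      M₁.E.Nonempty ∧ M₂.E.Nonempty ∧ M = M₁.disjointSum M₂ h

/-- A matroid is simple if it has neither loops nor parallel pairs, i.e. if every set of at most
two elements of the ground set is independent (`x = y` is allowed below). -/
def Matroid.IsSimpleMatroid {α : Type u} (M : Matroid α) : Prop :=
  ∀ x ∈ M.E, ∀ y ∈ M.E, M.Indep {x, y}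

/-- A matroid is binary if it is representable over the two-element field: its elements can be
mapped to vectors of a vector space over `𝔽₂` such that the independent sets are exactly the sets
which are mapped to linearly independent families. -/
def Matroid.IsBinary {α : Type u} (M : Matroid α) : Prop :=
  ∃ (W : Type u) (_ : AddCommGroup W) (_ : Module (ZMod 2) W) (v : α → W),
    ∀ I ⊆ M.E, M.Indep I ↔ LinearIndepOn (ZMod 2) v I

/-- The weak-map order `N ⪯ M`: the matroids have the same ground set, and every base of `N` is a
base of `M`. (Equality of the ranks follows, as a matroid has a base.) -/
def Matroid.WeakMapLE {α : Type u} (N M : Matroid α) : Prop :=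
  N.E = M.E ∧ {B | N.IsBase B} ⊆ {B | M.IsBase B}

/-- `M` is minimal, in the weak-map order, among the connected matroids on its ground set. -/
def Matroid.IsMinimalConnected {α : Type u} (M : Matroid α) : Prop :=
  M.IsConnectedMatroid ∧ ∀ N : Matroid α, N.IsConnectedMatroid → N.WeakMapLE M → N = M

/-- Type (b): non-binary, but minimal among the connected matroids. -/
def Matroid.IsTypeB {α : Type u} (M : Matroid α) : Prop :=
  ¬ M.IsBinary ∧ M.IsMinimalConnected

/-- The eight three-point lines on `{a, b, c, d, e, f, g, h}`, where the points
`a, b, c, d, e, f, g, h` are `0, 1, 2, 3, 4, 5, 6, 7`, in the order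
`afd, ebh, abg, efc, egd, ach, bcd, fgh`. -/
def eightLines : Finset (Finset (Fin 8)) :=
  {{0, 5, 3}, {4, 1, 7}, {0, 1, 6}, {4, 5, 2}, {4, 6, 3}, {0, 2, 7}, {1, 2, 3}, {5, 6, 7}}


/-!
The eight lines form the Möbius–Kantor configuration: the affine plane over `𝔽₃` with one point
removed. Two properties of it drive the minimality of `M`: a line-closed set containing three
non-collinear points is everything, and a colouring of the points with three colours, each used at
least twice, has a rainbow line.

Let `N` be connected, of rank 3, with all lines dependent. If `N` had a parallel class `P` with at
least two points, then, as `E \ P` has rank 3, some line would meet `P` in exactly one point `p`;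
its other two points lie with `P` in a flat `U` of rank 2, and connectivity leaves at least two
points outside `U`. A rainbow line for `P`, `U \ P`, `E \ U` is impossible, since two of its points
span the third. So `N` is simple, its flats are line-closed, and every non-collinear triple spans.
-/

open Matroid
open scoped Finset

section Connectivity

variable {α : Type u} {M : Matroid α} {X : Set α}

theorem exists_eq_disjointSum_restrict [M.RankFinite] (hX : X ⊆ M.E)
    (hr : M.eRk X + M.eRk (M.E \ X) ≤ M.eRank) :
    ∃ hd, M = (M ↾ X).disjointSum (M ↾ (M.E \ X)) hd := by
  have hd : Disjoint (M ↾ X).E (M ↾ (M.E \ X)).E := by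
    simpa only [restrict_ground_eq] using disjoint_sdiff_right
  refine ⟨hd, ext_indep (by simp [union_sdiff_cancel hX]) fun I hI ↦ ?_⟩
  simp only [disjointSum_indep_iff, restrict_ground_eq, restrict_indep_iff, inter_subset_right,
    and_true, union_sdiff_self]
  refine ⟨fun h ↦ ⟨h.inter_right _, h.inter_right _, hI.trans subset_union_right⟩,
    fun ⟨h₁, h₂, _⟩ ↦ ?_⟩
  obtain ⟨J₁, hJ₁, hIJ₁⟩ := h₁.subset_isBasis_of_subset inter_subset_right hX
  obtain ⟨J₂, hJ₂, hIJ₂⟩ := h₂.subset_isBasis_of_subset inter_subset_right sdiff_subset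
  have hrank : M.eRk (J₁ ∪ J₂) = M.eRank := by
    rw [hJ₁.eRk_eq_eRk_union, union_comm, hJ₂.eRk_eq_eRk_union, sdiff_union_of_subset hX,
      eRk_ground]
  have hcard : (J₁ ∪ J₂).encard ≤ M.eRk (J₁ ∪ J₂) :=
    calc (J₁ ∪ J₂).encard ≤ J₁.encard + J₂.encard := encard_union_le _ _
      _ = M.eRk X + M.eRk (M.E \ X) := by rw [hJ₁.encard_eq_eRk, hJ₂.encard_eq_eRk]
      _ ≤ M.eRk (J₁ ∪ J₂) := hr.trans hrank.ge
  refine ((M.isRkFinite_set _).indep_of_encard_le_eRk hcard).subset fun x hx ↦ ?_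
  by_cases hxX : x ∈ X
  · exact Or.inl (hIJ₁ ⟨hx, hxX⟩)
  · exact Or.inr (hIJ₂ ⟨hx, hI hx, hxX⟩)

theorem eRank_lt_eRk_add_eRk_sdiff [M.RankFinite] (hM : M.IsConnectedMatroid) (hX : X ⊆ M.E)
    (hne : X.Nonempty) (hne' : (M.E \ X).Nonempty) : M.eRank < M.eRk X + M.eRk (M.E \ X) := by
  by_contra! hle
  obtain ⟨hd, hM'⟩ := exists_eq_disjointSum_restrict hX hle
  exact hM ⟨_, _, hd, hne, hne', hM'⟩

theorem nontrivial_sdiff_of_eRk_add_one_le [M.RankFinite] (hM : M.IsConnectedMatroid)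
    (hX : X ⊆ M.E) (hne : X.Nonempty) (hr : M.eRk X + 1 ≤ M.eRank) : (M.E \ X).Nontrivial := by
  have hne' : (M.E \ X).Nonempty := by
    rw [sdiff_nonempty]
    intro hEX
    rw [hX.antisymm hEX, eRk_ground] at hr
    exact ((ENat.add_one_le_iff ((eRank_ne_top_iff M).2 ‹_›)).1 hr).false
  by_contra hsub
  have hone : M.eRk (M.E \ X) ≤ 1 :=
    (M.eRk_le_encard _).trans (encard_le_one_iff_subsingleton.2 (not_nontrivial_iff.1 hsub))
  exact (eRank_lt_eRk_add_eRk_sdiff hM hX hne hne').not_ge ((add_le_add_right hone _).trans hr)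

theorem isNonloop_of_isConnectedMatroid [M.RankFinite] (hM : M.IsConnectedMatroid)
    (hr : M.eRank ≠ 0) {x : α} (hx : x ∈ M.E) : M.IsNonloop x := by
  by_contra hloop
  have hzero : M.eRk {x} = 0 := ((not_isNonloop_iff hx).1 hloop).eRk_eq
  have hsub : {x} ⊆ M.E := singleton_subset_iff.2 hx
  have hne := singleton_nonempty x
  have hnt := nontrivial_sdiff_of_eRk_add_one_le hM hsub hne
    (by rwa [hzero, zero_add, Order.one_le_iff_ne_zero])
  have hlt := eRank_lt_eRk_add_eRk_sdiff hM hsub hne hnt.nonempty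
  rw [hzero, zero_add] at hlt
  exact hlt.not_ge (M.eRk_le_eRank _)

theorem isConnectedMatroid_of_exchange
    (h : ∀ x ∈ M.E, ∀ y ∈ M.E, x ≠ y →
      ∃ I, x ∉ I ∧ M.IsBase (insert x I) ∧ M.IsBase (insert y I)) :
    M.IsConnectedMatroid := by
  rintro ⟨M₁, M₂, hd, ⟨x, hx⟩, ⟨y, hy⟩, rfl⟩
  have hy₁ : y ∉ M₁.E := hd.notMem_of_mem_right hy
  obtain ⟨I, hxI, hBx, hBy⟩ := h x (by simp [hx]) y (by simp [hy]) (by rintro rfl; exact hy₁ hx)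
  have hB₁ := (disjointSum_isBase_iff.1 hBx).1
  have hB₁' := (disjointSum_isBase_iff.1 hBy).1
  rw [insert_inter_of_mem hx] at hB₁
  rw [insert_inter_of_notMem hy₁] at hB₁'
  have heq := hB₁'.eq_of_subset_isBase hB₁ (subset_insert _ _)
  exact hxI (heq.ge (mem_insert _ _)).1

end Connectivity

section Spanning

variable {α : Type u} {M N : Matroid α}

theorem subset_closure_of_not_indep {I C : Set α} (hI : M.Indep I) (hfin : C.Finite) (hIC : I ⊆ C)
    (hC : ¬ M.Indep C) (hcard : C.encard ≤ I.encard + 1) (hCE : C ⊆ M.E) :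
    C ⊆ M.closure I := by
  intro z hzC
  by_contra hz
  have hzI : z ∉ I := fun h ↦ hz (M.mem_closure_of_mem h (hIC.trans hCE))
  have hCeq : insert z I = C :=
    (hfin.subset (insert_subset hzC hIC)).eq_of_subset_of_encard_le (insert_subset hzC hIC)
      (by rwa [encard_insert_of_notMem hzI])
  exact hC (hCeq ▸ hI.insert_indep_iff.2 (Or.inl ⟨hCE hzC, hz⟩))

theorem indep_pair_of_mem_closure_singleton {e p a : α} (hp : M.IsNonloop p)
    (hpe : p ∈ M.closure {e}) (ha : a ∈ M.E) (hae : a ∉ M.closure {e}) : M.Indep {p, a} := by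
  rw [pair_comm]
  refine hp.indep.insert_indep_iff.2 (Or.inl ⟨ha, ?_⟩)
  rwa [hp.closure_eq_of_mem_closure hpe]

theorem eRk_closure_pair_le (M : Matroid α) (x y : α) : M.eRk (M.closure {x, y}) ≤ 2 := by
  rw [eRk_closure_eq]
  refine (M.eRk_le_encard _).trans ((encard_insert_le _ _).trans ?_)
  rw [encard_singleton, one_add_one_eq_two]

theorem eRank_eq_of_weakMapLE (h : N.WeakMapLE M) : N.eRank = M.eRank := by
  obtain ⟨B, hB⟩ := N.exists_isBase
  rw [← hB.encard_eq_eRank, (h.2 hB).encard_eq_eRank]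

theorem indep_of_weakMapLE (h : N.WeakMapLE M) {I : Set α} (hI : N.Indep I) : M.Indep I := by
  obtain ⟨B, hB, hIB⟩ := hI.exists_isBase_superset
  exact (h.2 hB).indep.subset hIB

end Spanning

theorem eq_add_of_linearIndepOn {α W : Type*} [AddCommGroup W] [Module (ZMod 2) W] {v : α → W}
    {x y z : α} (hxy : LinearIndepOn (ZMod 2) v {x, y}) (hxz : LinearIndepOn (ZMod 2) v {x, z})
    (hyz : LinearIndepOn (ZMod 2) v {y, z}) (hzx : z ≠ x) (hzy : z ≠ y)
    (h : ¬ LinearIndepOn (ZMod 2) v {x, y, z}) : v z = v x + v y := by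
  have hspan : v z ∈ Submodule.span (ZMod 2) {v x, v y} := by
    by_contra hcon
    rw [← image_pair] at hcon
    have hz : z ∉ ({x, y} : Set α) := by simp [hzx, hzy]
    refine h ?_
    rw [pair_comm y z, insert_comm]
    exact (linearIndepOn_insert hz).2 ⟨hxy, hcon⟩
  obtain ⟨a, b, hab⟩ := Submodule.mem_span_pair.1 hspan
  have hz0 : v z ≠ 0 := hxz.ne_zero (by simp)
  have hvx : v x ≠ v z := fun heq ↦ hzx.symm (hxz.injOn (by simp) (by simp) heq)
  have hvy : v y ≠ v z := fun heq ↦ hzy.symm (hyz.injOn (by simp) (by simp) heq)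
  have zero_or_one : ∀ c : ZMod 2, c = 0 ∨ c = 1 := by decide
  rcases zero_or_one a with rfl | rfl <;> rcases zero_or_one b with rfl | rfl <;> simp_all

/-- `ℒ` is the family of circuit-hyperplanes of a sparse paving matroid of rank `r`: the bases are
the remaining `r`-element sets. -/
structure IsSparsePaving {α : Type u} [DecidableEq α] (r : ℕ) (ℒ : Set (Finset α)) : Prop where
  card_eq : ∀ L ∈ ℒ, #L = r
  card_inter_add_two_le : ∀ L ∈ ℒ, ∀ L' ∈ ℒ, L ≠ L' → #(L ∩ L') + 2 ≤ r
  exists_notMem : ∃ B : Finset α, #B = r ∧ B ∉ ℒ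

namespace IsSparsePaving

variable {α : Type u} [DecidableEq α] {r : ℕ} {ℒ : Set (Finset α)} {L S T : Finset α}

theorem eq_of_common_subset (h : IsSparsePaving r ℒ) {L' A : Finset α} (hL : L ∈ ℒ) (hL' : L' ∈ ℒ)
    (hA : A ⊆ L) (hA' : A ⊆ L') (hcard : r ≤ #A + 1) : L = L' := by
  by_contra hne
  have := h.card_inter_add_two_le L hL L' hL' hne
  have := Finset.card_le_card (Finset.subset_inter hA hA')
  omega

theorem card_insert_erase {a b : α} (hS : #S = r) (ha : a ∈ S) (hb : b ∉ S) :
    #(insert b (S.erase a)) = r := by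
  rw [Finset.card_insert_of_notMem fun h ↦ hb (Finset.mem_of_mem_erase h),
    Finset.card_erase_add_one ha, hS]

theorem exists_insert_erase_notMem (h : IsSparsePaving r ℒ) (hS : #S = r) (hT : #T = r)
    (hTℒ : T ∉ ℒ) {a : α} (haS : a ∈ S) (haT : a ∉ T) :
    ∃ b ∈ T, b ∉ S ∧ insert b (S.erase a) ∉ ℒ := by
  by_contra! hall
  obtain ⟨b, hbT, hbS⟩ : ∃ b ∈ T, b ∉ S := by
    by_contra! hTS
    exact haT (Finset.eq_of_subset_of_card_le hTS (hS.trans hT.symm).le ▸ haS)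
  have hcard := card_insert_erase hS haS hbS
  have hTsub : T ⊆ insert b (S.erase a) := fun c hcT ↦ by
    by_cases hcS : c ∈ S
    · exact Finset.mem_insert_of_mem (Finset.mem_erase.2 ⟨by rintro rfl; exact haT hcT, hcS⟩)
    · rw [h.eq_of_common_subset (hall b hbT hbS) (hall c hcT hcS) (Finset.subset_insert _ _)
        (Finset.subset_insert _ _) (by rw [Finset.card_erase_add_one haS, hS])]
      exact Finset.mem_insert_self _ _
  exact hTℒ (Finset.eq_of_subset_of_card_le hTsub (hcard.trans hT.symm).le ▸ hall b hbT hbS)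

theorem insert_erase_notMem (h : IsSparsePaving r ℒ) (hL : L ∈ ℒ) {w x : α} (hw : w ∉ L)
    (hx : x ∈ L) : insert w (L.erase x) ∉ ℒ := fun hmem ↦ by
  have heq := h.eq_of_common_subset hL hmem (L.erase_subset x) (Finset.subset_insert _ _)
    (by rw [Finset.card_erase_add_one hx, h.card_eq L hL])
  exact hw (heq ▸ Finset.mem_insert_self _ _)

theorem exists_notMem_of_mem (h : IsSparsePaving r ℒ) (hL : L ∈ ℒ) : ∃ w, w ∉ L := by
  by_contra! hall
  obtain ⟨B, hB, hBℒ⟩ := h.exists_notMem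
  have hBL := Finset.eq_of_subset_of_card_le (fun b _ ↦ hall b) (by rw [hB, h.card_eq L hL])
  exact hBℒ (hBL ▸ hL)

theorem nonempty_of_mem (h : IsSparsePaving r ℒ) (hL : L ∈ ℒ) : L.Nonempty := by
  by_contra hempty
  obtain ⟨B, hB, hBℒ⟩ := h.exists_notMem
  rw [Finset.not_nonempty_iff_eq_empty] at hempty
  rw [← h.card_eq L hL, hempty, Finset.card_empty, Finset.card_eq_zero] at hB
  exact hBℒ (hB ▸ hempty ▸ hL)

/-- The sparse paving matroid whose bases are the `r`-element sets outside `ℒ`. -/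
def matroid (h : IsSparsePaving r ℒ) : Matroid α :=
  Matroid.ofExistsFiniteIsBase univ
    (fun B ↦ ∃ S : Finset α, (#S = r ∧ S ∉ ℒ) ∧ (S : Set α) = B)
    (let ⟨B, hB⟩ := h.exists_notMem; ⟨B, ⟨B, hB, rfl⟩, B.finite_toSet⟩)
    (by
      rintro _ _ ⟨S, hS, rfl⟩ ⟨T, hT, rfl⟩ a ⟨haS, haT⟩
      obtain ⟨b, hbT, hbS, hb⟩ := h.exists_insert_erase_notMem hS.1 hT.1 hT.2 haS haT
      exact ⟨b, ⟨hbT, hbS⟩, _, ⟨card_insert_erase hS.1 haS hbS, hb⟩, by simp⟩)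
    fun _ _ ↦ subset_univ _

variable (h : IsSparsePaving r ℒ)

theorem isBase_coe_iff : h.matroid.IsBase S ↔ #S = r ∧ S ∉ ℒ := by
  change (∃ T : Finset α, (#T = r ∧ T ∉ ℒ) ∧ (T : Set α) = S) ↔ _
  simp

theorem isBase_coe_iff_forall_card_inter_lt :
    h.matroid.IsBase S ↔ #S = r ∧ ∀ L ∈ ℒ, #(S ∩ L) < r := by
  rw [h.isBase_coe_iff]
  refine and_congr_right fun hS ↦ ⟨fun hSℒ L hL ↦ ?_, fun hlt hSℒ ↦ ?_⟩
  · by_contra! hle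
    have hSL := Finset.eq_of_subset_of_card_le Finset.inter_subset_left (hS.trans_le hle)
    have hLS := Finset.eq_of_subset_of_card_le Finset.inter_subset_right
      ((h.card_eq L hL).trans_le hle)
    exact hSℒ (hSL.symm.trans hLS ▸ hL)
  · simpa [hS] using hlt S hSℒ

theorem eRank_matroid : h.matroid.eRank = r := by
  obtain ⟨B, hB⟩ := h.exists_notMem
  rw [← (h.isBase_coe_iff.2 hB).encard_eq_eRank, encard_coe_eq_coe_finsetCard, hB.1]

theorem not_indep_of_mem (hL : L ∈ ℒ) : ¬ h.matroid.Indep L := fun hI ↦ by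
  refine (h.isBase_coe_iff.1 (hI.isBase_of_eRk_ge L.finite_toSet ?_)).2 hL
  rw [hI.eRk_eq_encard, h.eRank_matroid, encard_coe_eq_coe_finsetCard, h.card_eq L hL]

theorem mem_of_subset_of_eRk_lt {F : Set α} (hF : h.matroid.eRk F < r) (hS : #S = r)
    (hSF : (S : Set α) ⊆ F) : S ∈ ℒ := by
  by_contra hSℒ
  refine hF.not_ge ?_
  rw [← h.eRank_matroid, ← (h.isBase_coe_iff.2 ⟨hS, hSℒ⟩).eRk_eq_eRank]
  exact h.matroid.eRk_mono hSF

theorem subset_of_mem_of_eRk_lt {F : Set α} (hF : h.matroid.eRk F < r) (hL : L ∈ ℒ)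
    (hLF : (L : Set α) ⊆ F) : F ⊆ L := by
  intro w hwF
  by_contra hwL
  obtain ⟨x, hx⟩ := h.nonempty_of_mem hL
  refine h.insert_erase_notMem hL hwL hx
    (h.mem_of_subset_of_eRk_lt hF (card_insert_erase (h.card_eq L hL) hx hwL) ?_)
  rw [Finset.coe_insert]
  exact insert_subset hwF ((Finset.coe_subset.2 (L.erase_subset x)).trans hLF)

theorem eRk_lt_of_mem (hL : L ∈ ℒ) : h.matroid.eRk L < r := by
  calc h.matroid.eRk L < (L : Set α).encard :=
        eRk_lt_encard_of_dep_of_finite L.finite_toSet ⟨h.not_indep_of_mem hL, subset_univ _⟩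
    _ = r := by rw [encard_coe_eq_coe_finsetCard, h.card_eq L hL]

theorem eRk_add_one_of_mem (hL : L ∈ ℒ) : h.matroid.eRk L + 1 = r := by
  obtain ⟨x, hx⟩ := h.nonempty_of_mem hL
  obtain ⟨w, hw⟩ := h.exists_notMem_of_mem hL
  have hbase := h.isBase_coe_iff.2
    ⟨card_insert_erase (h.card_eq L hL) hx hw, h.insert_erase_notMem hL hw hx⟩
  have hindep : h.matroid.Indep (L.erase x) :=
    hbase.indep.subset (Finset.coe_subset.2 (Finset.subset_insert _ _))
  have hcard : (L.erase x : Finset α).card + 1 = r := by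
    rw [Finset.card_erase_add_one hx, h.card_eq L hL]
  refine (Order.add_one_le_of_lt (h.eRk_lt_of_mem hL)).antisymm ?_
  calc (r : ℕ∞) = (L.erase x : Set α).encard + 1 := by
        rw [encard_coe_eq_coe_finsetCard, ← Nat.cast_add_one, hcard]
    _ ≤ h.matroid.eRk L + 1 := by
        gcongr
        exact hindep.encard_le_eRk_of_subset (Finset.coe_subset.2 (L.erase_subset x))

theorem isFlat_of_mem (hL : L ∈ ℒ) : h.matroid.IsFlat L := by
  have hsub := h.matroid.subset_closure L (subset_univ _)
  have hlt : h.matroid.eRk (h.matroid.closure L) < r := by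
    rw [eRk_closure_eq]
    exact h.eRk_lt_of_mem hL
  exact isFlat_iff_closure_eq.2 ((h.subset_of_mem_of_eRk_lt hlt hL hsub).antisymm hsub)

theorem isFlat_and_eRk_add_one_and_le_encard_iff {F : Set α} :
    h.matroid.IsFlat F ∧ h.matroid.eRk F + 1 = r ∧ r ≤ F.encard ↔ ∃ L ∈ ℒ, F = L := by
  constructor
  · rintro ⟨-, hr, hcard⟩
    have hlt : h.matroid.eRk F < r := by
      refine (ENat.add_one_le_iff fun htop ↦ ?_).1 hr.le
      simp [htop] at hr
    obtain ⟨S, hSF, hS⟩ := exists_subset_encard_eq hcard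
    lift S to Finset α using finite_of_encard_eq_coe hS
    rw [encard_coe_eq_coe_finsetCard, Nat.cast_inj] at hS
    have hSℒ := h.mem_of_subset_of_eRk_lt hlt hS hSF
    exact ⟨S, hSℒ, (h.subset_of_mem_of_eRk_lt hlt hSℒ hSF).antisymm hSF⟩
  · rintro ⟨L, hL, rfl⟩
    refine ⟨h.isFlat_of_mem hL, h.eRk_add_one_of_mem hL, ?_⟩
    rw [encard_coe_eq_coe_finsetCard, h.card_eq L hL]

end IsSparsePaving

section Lines

variable {α : Type u} {ℒ : Set (Finset α)} {N : Matroid α}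

/-- A set of points is line-closed if it contains every line that it meets in two points. -/
def IsLineClosed (ℒ : Set (Finset α)) (U : Set α) : Prop :=
  ∀ L ∈ ℒ, ((L : Set α) ∩ U).Nontrivial → (L : Set α) ⊆ U

/-- Every triple of points that is not a line generates all points under line closure. -/
def TrianglesGenerate (ℒ : Set (Finset α)) : Prop :=
  ∀ U, IsLineClosed ℒ U → ∀ B : Finset α, #B = 3 → B ∉ ℒ → (B : Set α) ⊆ U → U = univ

/-- Every colouring of the points with three colours, each used at least twice, has a line on which
all three colours occur. -/
def ForcesRainbowLine (ℒ : Set (Finset α)) : Prop :=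
  ∀ c : α → Fin 3, (∀ k, (c ⁻¹' {k}).Nontrivial) → ∃ L ∈ ℒ, ∀ k, ∃ i ∈ L, c i = k

theorem ForcesRainbowLine.exists_line (hrain : ForcesRainbowLine ℒ) {P U : Set α} (hPU : P ⊆ U)
    (hP : P.Nontrivial) (hUP : (U \ P).Nontrivial) (hU : Uᶜ.Nontrivial) :
    ∃ L ∈ ℒ, (∃ p ∈ L, p ∈ P) ∧ (∃ a ∈ L, a ∈ U \ P) ∧ ∃ b ∈ L, b ∉ U := by
  classical
  let c : α → Fin 3 := fun i ↦ if i ∈ P then 0 else if i ∈ U then 1 else 2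
  have hc₀ (i : α) : c i = 0 ↔ i ∈ P := by grind
  have hc₁ (i : α) : c i = 1 ↔ i ∈ U \ P := by grind
  have hc₂ (i : α) : c i = 2 ↔ i ∉ U := by grind
  obtain ⟨L, hL, hLc⟩ := hrain c fun k ↦ by
    fin_cases k
    · exact hP.mono fun i ↦ (hc₀ i).2
    · exact hUP.mono fun i ↦ (hc₁ i).2
    · exact hU.mono fun i ↦ (hc₂ i).2
  simp only [← hc₀, ← hc₁, ← hc₂]
  exact ⟨L, hL, hLc 0, hLc 1, hLc 2⟩

/-- `N` is a matroid on all of `α` in which the members of `ℒ` are dependent triples. It may have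
further dependent triples, and a member of `ℒ` may have rank less than 2. -/
structure HasLines (N : Matroid α) (ℒ : Set (Finset α)) : Prop where
  ground_eq : N.E = univ
  card_eq : ∀ L ∈ ℒ, #L = 3
  not_indep : ∀ L ∈ ℒ, ¬ N.Indep L

namespace HasLines

variable (h : HasLines N ℒ) {L : Finset α}
include h

theorem mem_ground (x : α) : x ∈ N.E := h.ground_eq ▸ mem_univ x

theorem subset_ground (X : Set α) : X ⊆ N.E := fun x _ ↦ h.mem_ground x

theorem subset_closure_of_indep_pair (hL : L ∈ ℒ) {X : Set α} {x y : α} (hxL : x ∈ L) (hyL : y ∈ L)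
    (hxX : x ∈ N.closure X) (hyX : y ∈ N.closure X) (hxy : x ≠ y) (hind : N.Indep {x, y}) :
    (L : Set α) ⊆ N.closure X := by
  have hcard : (L : Set α).encard ≤ ({x, y} : Set α).encard + 1 := by
    rw [encard_coe_eq_coe_finsetCard, h.card_eq L hL, encard_pair hxy]
    norm_num
  exact (subset_closure_of_not_indep hind L.finite_toSet (pair_subset hxL hyL) (h.not_indep L hL)
      hcard (h.subset_ground _)).trans
    (N.closure_subset_closure_of_subset_closure (pair_subset hxX hyX))

theorem isLineClosed_closure (hN : N.IsSimpleMatroid) (X : Set α) :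
    IsLineClosed ℒ (N.closure X) := by
  rintro L hL ⟨x, ⟨hxL, hxX⟩, y, ⟨hyL, hyX⟩, hxy⟩
  exact h.subset_closure_of_indep_pair hL hxL hyL hxX hyX hxy
    (hN x (h.mem_ground x) y (h.mem_ground y))

theorem indep_of_notMem (hgen : TrianglesGenerate ℒ) (hr : N.eRank = 3) (hN : N.IsSimpleMatroid)
    {B : Finset α} (hB : #B = 3) (hBℒ : B ∉ ℒ) : N.Indep B := by
  have hspan : N.closure B = univ := hgen _ (h.isLineClosed_closure hN B) B hB hBℒ
    (N.subset_closure B (h.subset_ground _))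
  refine (N.isRkFinite_of_finite B.finite_toSet).indep_of_encard_le_eRk ?_
  rw [← eRk_closure_eq, hspan, ← h.ground_eq, eRk_ground, hr, encard_coe_eq_coe_finsetCard, hB]
  rfl

theorem eq_univ_of_isLineClosed (hgen : TrianglesGenerate ℒ) {U : Set α} (hU : IsLineClosed ℒ U)
    (hr : 3 ≤ N.eRk U) : U = univ := by
  obtain ⟨I, hIU, hI, hcard⟩ := le_eRk_iff.1 hr
  lift I to Finset α using finite_of_encard_eq_coe hcard
  rw [encard_coe_eq_coe_finsetCard] at hcard
  exact hgen U hU I (by exact_mod_cast hcard) (fun hIℒ ↦ h.not_indep I hIℒ hI) hIU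

theorem exists_line_sdiff_closure_nontrivial [N.RankFinite] (hgen : TrianglesGenerate ℒ)
    (hr : N.eRank = 3) (hN : N.IsConnectedMatroid) (e : α) :
    ∃ L ∈ ℒ, (∃ p ∈ L, p ∈ N.closure {e}) ∧ ((L : Set α) \ N.closure {e}).Nontrivial := by
  have he : e ∈ N.closure {e} := N.mem_closure_self e (h.mem_ground e)
  have hone : N.eRk (N.closure {e}) ≤ 1 := (eRk_closure_eq ..).trans_le (N.eRk_singleton_le e)
  have hsub := N.closure_subset_ground {e}
  have hne := nontrivial_sdiff_of_eRk_add_one_le hN hsub ⟨e, he⟩ (by grw [hone, hr]; norm_num)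
  have hlt := eRank_lt_eRk_add_eRk_sdiff hN hsub ⟨e, he⟩ hne.nonempty
  rw [h.ground_eq, ← compl_eq_univ_sdiff, hr] at hlt
  have hthree : 3 ≤ N.eRk (N.closure {e})ᶜ := by
    grw [hone] at hlt
    rw [add_comm] at hlt
    exact Order.le_of_lt_add_one hlt
  have hopen : ¬ IsLineClosed ℒ (N.closure {e})ᶜ := fun hclosed ↦
    (h.eq_univ_of_isLineClosed hgen hclosed hthree).ge (mem_univ e) he
  simp only [IsLineClosed, not_forall, not_subset, mem_compl_iff, not_not] at hopen
  obtain ⟨L, hL, hnt, hp⟩ := hopen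
  exact ⟨L, hL, hp, hnt⟩

theorem subset_closure_of_mem_parallel_class (hloop : ∀ x, N.IsNonloop x) {X : Set α} {e p a : α}
    (he : e ∈ X) (hp : p ∈ N.closure {e}) (ha : a ∈ N.closure X) (hae : a ∉ N.closure {e})
    (hL : L ∈ ℒ) (hpL : p ∈ L) (haL : a ∈ L) : (L : Set α) ⊆ N.closure X :=
  h.subset_closure_of_indep_pair hL hpL haL
    (N.closure_subset_closure (singleton_subset_iff.2 he) hp) ha (by rintro rfl; exact hae hp)
    (indep_pair_of_mem_closure_singleton (hloop p) hp (h.mem_ground a) hae)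

theorem isSimpleMatroid_of_isConnectedMatroid (hgen : TrianglesGenerate ℒ)
    (hrain : ForcesRainbowLine ℒ) (hr : N.eRank = 3) (hN : N.IsConnectedMatroid) :
    N.IsSimpleMatroid := by
  have : N.RankFinite := (eRank_ne_top_iff N).1 (by simp [hr])
  have hloop (x : α) : N.IsNonloop x :=
    isNonloop_of_isConnectedMatroid hN (by simp [hr]) (h.mem_ground x)
  intro e _ f hf
  by_contra hef
  have he : e ∈ N.closure {e} := N.mem_closure_self e (h.mem_ground e)
  have hfe : f ∈ N.closure {e} := by
    by_contra hfe
    exact hef (indep_pair_of_mem_closure_singleton (hloop e) he hf hfe)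
  have hne : e ≠ f := by
    rintro rfl
    exact hef (by simpa using (hloop e).indep)
  obtain ⟨L, hL, ⟨p, hpL, hp⟩, x, ⟨hxL, hx⟩, y, ⟨hyL, hy⟩, hxy⟩ :=
    h.exists_line_sdiff_closure_nontrivial hgen hr hN e
  have hxU : x ∈ N.closure {e, x} := N.mem_closure_of_mem (by simp) (h.subset_ground _)
  have hPU : N.closure {e} ⊆ N.closure {e, x} := N.closure_subset_closure (by simp)
  have hLU := h.subset_closure_of_mem_parallel_class hloop (mem_insert e {x}) hp hxU hx hL hpL hxL
  have hU : (N.closure {e, x})ᶜ.Nontrivial := by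
    rw [compl_eq_univ_sdiff, ← h.ground_eq]
    refine nontrivial_sdiff_of_eRk_add_one_le hN (N.closure_subset_ground _) ⟨x, hxU⟩ ?_
    grw [eRk_closure_pair_le, hr]
    norm_num
  obtain ⟨L', hL', ⟨p', hp'L, hp'⟩, ⟨a, haL, haU, ha⟩, b, hbL, hb⟩ :=
    hrain.exists_line hPU ⟨e, he, f, hfe, hne⟩ ⟨x, ⟨hxU, hx⟩, y, ⟨hLU hyL, hy⟩, hxy⟩ hU
  exact hb (h.subset_closure_of_mem_parallel_class hloop (mem_insert e {x}) hp' haU ha hL' hp'L haL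
    hbL)

end HasLines

theorem IsSparsePaving.hasLines_matroid [DecidableEq α] (h : IsSparsePaving 3 ℒ) :
    HasLines h.matroid ℒ :=
  ⟨rfl, h.card_eq, fun _ ↦ h.not_indep_of_mem⟩

theorem HasLines.of_weakMapLE {M : Matroid α} (h : HasLines M ℒ) (hNM : N.WeakMapLE M) :
    HasLines N ℒ :=
  ⟨hNM.1.trans h.ground_eq, h.card_eq, fun L hL hI ↦ h.not_indep L hL (indep_of_weakMapLE hNM hI)⟩

theorem IsSparsePaving.isMinimalConnected [DecidableEq α] (h : IsSparsePaving 3 ℒ)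
    (hgen : TrianglesGenerate ℒ) (hrain : ForcesRainbowLine ℒ)
    (hM : h.matroid.IsConnectedMatroid) : h.matroid.IsMinimalConnected := by
  refine ⟨hM, fun N hN hNM ↦ ext_isBase hNM.1 fun B _ ↦ ⟨fun hB ↦ hNM.2 hB, ?_⟩⟩
  rintro ⟨B, ⟨hB, hBℒ⟩, rfl⟩
  have hr : N.eRank = 3 := (eRank_eq_of_weakMapLE hNM).trans h.eRank_matroid
  have hlines := h.hasLines_matroid.of_weakMapLE hNM
  have hsimple := hlines.isSimpleMatroid_of_isConnectedMatroid hgen hrain hr hN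
  have hI := hlines.indep_of_notMem hgen hr hsimple hB hBℒ
  refine hI.isBase_of_eRk_ge B.finite_toSet ?_
  rw [hI.eRk_eq_encard, encard_coe_eq_coe_finsetCard, hB, hr]
  rfl

end Lines

namespace eightLines

theorem isSparsePaving : IsSparsePaving 3 (eightLines : Set (Finset (Fin 8))) where
  card_eq := by
    simp only [Finset.mem_coe]
    decide +kernel
  card_inter_add_two_le := by
    simp only [Finset.mem_coe]
    decide +kernel
  exists_notMem := ⟨{0, 1, 2}, by simp only [Finset.mem_coe]; decide +kernel⟩

theorem eq_univ_or_mem_or_card_le_two :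
    ∀ U : Finset (Fin 8), (∀ L ∈ eightLines, 1 < #(L ∩ U) → L ⊆ U) →
      U = Finset.univ ∨ U ∈ eightLines ∨ #U ≤ 2 := by
  decide +kernel

theorem trianglesGenerate : TrianglesGenerate (eightLines : Set (Finset (Fin 8))) := by
  intro U hU B hB hBℒ hBU
  lift U to Finset (Fin 8) using toFinite U
  have hclosed : ∀ L ∈ eightLines, 1 < #(L ∩ U) → L ⊆ U := fun L hL hLU ↦ by
    have hnt : ((L ∩ U : Finset (Fin 8)) : Set (Fin 8)).Nontrivial :=
      Finset.one_lt_card_iff_nontrivial.1 hLU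
    rw [Finset.coe_inter] at hnt
    exact Finset.coe_subset.1 (hU L hL hnt)
  have hBU : B ⊆ U := Finset.coe_subset.1 hBU
  obtain rfl | hUℒ | hcard := eq_univ_or_mem_or_card_le_two U hclosed
  · exact Finset.coe_univ
  · have hBU' := Finset.eq_of_subset_of_card_le hBU (by rw [hB, isSparsePaving.card_eq U hUℒ])
    exact absurd hUℒ (hBU' ▸ hBℒ)
  · have := Finset.card_le_card hBU
    omega

/- Join two points other than `p` and `q` if a line through `p` or `q` contains both. This graph is
a 6-cycle if `p` and `q` are not collinear, and a path on five points with an isolated sixth point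
if they are. In either case it has an edge leaving `A`, as neither `A` nor the set of the remaining
points is contained in the isolated point. -/
theorem exists_line_of_pair :
    ∀ p q : Fin 8, p ≠ q → ∀ A : Finset (Fin 8), p ∉ A → q ∉ A → 2 ≤ #A →
      2 ≤ #(insert p (insert q A))ᶜ →
      ∃ L ∈ eightLines, (p ∈ L ∨ q ∈ L) ∧ (∃ i ∈ L, i ∈ A) ∧
        ∃ i ∈ L, i ∉ insert p (insert q A) := by
  decide +kernel

theorem exists_fiber_card_eq_two {c : Fin 8 → Fin 3} (hc : ∀ k, 2 ≤ #{i | c i = k}) :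
    ∃ k, #{i | c i = k} = 2 := by
  by_contra! hne
  have hsum := Finset.card_eq_sum_card_fiberwise (s := Finset.univ) (t := Finset.univ) (f := c)
    fun i _ ↦ Finset.mem_coe.2 (Finset.mem_univ (c i))
  have hthree : ∑ _k : Fin 3, 3 ≤ ∑ k, #{i | c i = k} :=
    Finset.sum_le_sum fun k _ ↦ (hc k).lt_of_ne' (hne k)
  rw [← hsum] at hthree
  simp at hthree

theorem forcesRainbowLine : ForcesRainbowLine (eightLines : Set (Finset (Fin 8))) := by
  intro c hc
  have htwo (k : Fin 3) : 2 ≤ #{i | c i = k} := by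
    refine Finset.one_lt_card_iff_nontrivial.2 ((hc k).mono fun i hi ↦ ?_)
    simpa using hi
  obtain ⟨k, hk⟩ := exists_fiber_card_eq_two htwo
  obtain ⟨p, q, hpq, hpair⟩ := Finset.card_eq_two.1 hk
  have hcolour (i : Fin 8) : c i = k ↔ i = p ∨ i = q := by
    simpa using Finset.ext_iff.1 hpair i
  have hthree : ∀ k : Fin 3, ∃ m n, m ≠ k ∧ n ≠ k ∧ n ≠ m ∧ ∀ j, j = k ∨ j = m ∨ j = n := by
    decide
  obtain ⟨m, n, hmk, hnk, hnm, hkmn⟩ := hthree k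
  have hrest (i : Fin 8) : i ∉ insert p (insert q ({i | c i = m} : Finset (Fin 8))) ↔ c i = n := by
    grind
  have hrest_card : 2 ≤ #(insert p (insert q ({i | c i = m} : Finset (Fin 8))))ᶜ :=
    (htwo n).trans (Finset.card_le_card fun i hi ↦
      Finset.mem_compl.2 ((hrest i).2 (by simpa using hi)))
  obtain ⟨L, hL, hpqL, ⟨i, hiL, hi⟩, j, hjL, hj⟩ := exists_line_of_pair p q hpq {i | c i = m}
    (by grind) (by grind) (htwo m) hrest_card
  refine ⟨L, hL, fun l ↦ ?_⟩
  obtain rfl | rfl | rfl := hkmn l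
  · exact hpqL.elim (fun h ↦ ⟨p, h, (hcolour p).2 (Or.inl rfl)⟩)
      fun h ↦ ⟨q, h, (hcolour q).2 (Or.inr rfl)⟩
  · exact ⟨i, hiL, by simpa using hi⟩
  · exact ⟨j, hjL, (hrest j).1 hj⟩

/-- The matroid `M` of the theorem, whose bases are the triples that are not among the eight
lines. -/
abbrev matroid : Matroid (Fin 8) := isSparsePaving.matroid

theorem isConnectedMatroid : matroid.IsConnectedMatroid := by
  have hexch : ∀ x y : Fin 8, x ≠ y → ∃ w z, x ∉ ({w, z} : Finset (Fin 8)) ∧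
      (#{x, w, z} = 3 ∧ {x, w, z} ∉ eightLines) ∧ #{y, w, z} = 3 ∧ {y, w, z} ∉ eightLines := by
    decide +kernel
  refine isConnectedMatroid_of_exchange fun x _ y _ hxy ↦ ?_
  obtain ⟨w, z, hxI, hx, hy⟩ := hexch x y hxy
  refine ⟨({w, z} : Finset (Fin 8)), Finset.mem_coe.not.2 hxI, ?_, ?_⟩
  · rw [← Finset.coe_insert]
    exact isSparsePaving.isBase_coe_iff.2 hx
  · rw [← Finset.coe_insert]
    exact isSparsePaving.isBase_coe_iff.2 hy

theorem isSimpleMatroid : matroid.IsSimpleMatroid :=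
  isSparsePaving.hasLines_matroid.isSimpleMatroid_of_isConnectedMatroid trianglesGenerate
    forcesRainbowLine isSparsePaving.eRank_matroid isConnectedMatroid

theorem isMinimalConnected : matroid.IsMinimalConnected :=
  isSparsePaving.isMinimalConnected trianglesGenerate forcesRainbowLine isConnectedMatroid

theorem not_isBinary : ¬ matroid.IsBinary := by
  rintro ⟨W, _, _, v, hv⟩
  have hpair (x y : Fin 8) : LinearIndepOn (ZMod 2) v {x, y} :=
    (hv _ (subset_univ _)).1 (isSimpleMatroid x (mem_univ x) y (mem_univ y))
  have hline {x y z : Fin 8} (hL : {x, y, z} ∈ eightLines) (hzx : z ≠ x) (hzy : z ≠ y) :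
      v z = v x + v y := by
    refine eq_add_of_linearIndepOn (hpair x y) (hpair x z) (hpair y z) hzx hzy ?_
    rw [← hv _ (subset_univ _)]
    simpa using isSparsePaving.not_indep_of_mem hL
  have hh : v 7 = v 0 + v 2 := hline (by decide) (by decide) (by decide)
  have hd : v 3 = v 1 + v 2 := hline (by decide) (by decide) (by decide)
  have hf : v 5 = v 0 + v 3 := hline (by decide) (by decide) (by decide)
  have he : v 4 = v 1 + v 7 := hline (by decide) (by decide) (by decide)
  have hef : v 4 = v 5 := by
    rw [he, hf, hh, hd]
    abel
  exact absurd ((hpair 4 5).injOn (by simp) (by simp) hef) (by decide)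

theorem isBase_iff {B : Set (Fin 8)} : matroid.IsBase B ↔
    B.ncard = 3 ∧ ∀ L ∈ eightLines, (B ∩ (L : Set (Fin 8))).ncard ≤ 2 := by
  lift B to Finset (Fin 8) using toFinite B
  simp only [isSparsePaving.isBase_coe_iff_forall_card_inter_lt, ← Finset.coe_inter,
    ncard_coe_finset, Finset.mem_coe, Nat.lt_succ_iff]

theorem isFlat_and_eRk_eq_two_iff {F : Set (Fin 8)} :
    matroid.IsFlat F ∧ matroid.eRk F = 2 ∧ 3 ≤ F.ncard ↔ ∃ L ∈ eightLines, F = L := by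
  have hrank : matroid.eRk F = 2 ↔ matroid.eRk F + 1 = (3 : ℕ) :=
    ((ENat.add_left_injective_of_ne_top ENat.one_ne_top).eq_iff' rfl).symm
  rw [hrank, ← Nat.cast_le (α := ℕ∞), (toFinite F).cast_ncard_eq]
  exact isSparsePaving.isFlat_and_eRk_add_one_and_le_encard_iff

end eightLines

open eightLines

theorem theorem4p3 :
    (eightLines.card = 8 ∧ ∀ L ∈ eightLines, L.card = 3) ∧
    ∃ M : Matroid (Fin 8),
      M.E = Set.univ ∧
      (∀ B : Set (Fin 8), M.IsBase B ↔
        B.ncard = 3 ∧ ∀ L ∈ eightLines, (B ∩ (L : Set (Fin 8))).ncard ≤ 2) ∧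
      M.eRank = 3 ∧
      {F : Set (Fin 8) | M.IsFlat F ∧ M.eRk F = 2 ∧ 3 ≤ F.ncard} =
        {F : Set (Fin 8) | ∃ L ∈ eightLines, F = (L : Set (Fin 8))} ∧
      M.IsSimpleMatroid ∧
      M.IsConnectedMatroid ∧
      M.IsTypeB := by
  refine ⟨⟨rfl, isSparsePaving.card_eq⟩, matroid, rfl, fun _ ↦ isBase_iff,
    isSparsePaving.eRank_matroid, ?_, isSimpleMatroid, isConnectedMatroid, not_isBinary,
    isMinimalConnected⟩
  ext F
  exact isFlat_and_eRk_eq_two_iff
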